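/- A mean is a function $M:\mathbb{R}^+\times\mathbb{R}^+\to\mathbb{R}^+$ with $\min(s,t)\le M(s,t)\le\max(s,t)$; it is homogeneous if $M(\lambda s,\lambda t)=\lambda M(s,t)$ for all $\lambda,s,t>0$. For means $K,M,N$ the resultant mean-map is $$\mathcal R(K,M,N)(s,t)=K\bigl(M(s,N(s,t)),\,M(N(s,t),t)\bigr).$$ We write $f(x)\sim\sum_{n\ge0}c_n x^{1-n}$ as $x\to\infty$ if $f(x)=\sum_{n=0}^{m}c_nx^{1-n}+o(x^{1-m})$ for every $m\in\mathbb{N}_0$. For a real sequence $\mathbf a=(a_i)_{i\ge0}$ and $r\in\mathbb{R}$ let $P[0,r,\mathbf a]=a_0^r$ and $$P[n,r,\mathbf a]=\frac1{na_0}\sum_{k=1}^n\bigl(k(1+r)-n\bigr)a_kP[n-k,r,\mathbf a],\qquad n\ge1 .$$ **Theorem.** Let $K,M,N$ be homogeneous means (not necessarily symmetric), let $t\in\mathbb{R}$, and suppose that, as $x\to\infty$, $$K(x-t,x+t)\sim\sum_{n\ge0}a_n^Kt^nx^{1-n},\quad M(x-t,x+t)\sim\sum_{n\ge0}a_n^Mt^nx^{1-n},\quad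 N(x-t,x+t)\sim\sum_{n\ge0}a_n^Nt^nx^{1-n},$$ with real coefficients (which may depend on $t$, for instance on its sign) such that $a_1^N\ne\pm1$. Then $$\mathcal R(K,M,N)(x-t,x+t)\sim\sum_{m\ge0}a_m^Rt^mx^{1-m}\qquad (x\to\infty),$$ $$a_m^R=\frac14\sum_{n=0}^m\sum_{k=0}^{m-n}a_n^K\,P[k,n,\mathbf d]\,P[m-n-k,-n+1,\mathbf s],\qquad m\ge0,$$ where $$d_{m-1}=\sum_{n=0}^ma_n^M\sum_{k=0}^{m-n}\bigl(P[k,n,\tilde{\mathbf g}]P[m-n-k,-n+1,\tilde{\mathbf h}]-P[k,n,\mathbf g]P[m-n-k,-n+1,\mathbf h]\bigr),\quad m\ge1,$$ $$s_m=\sum_{n=0}^ma_n^M\sum_{k=0}^{m-n}\bigl(P[k,n,\tilde{\mathbf g}]P[m-n-k,-n+1,\tilde{\mathbf h}]+P[k,n,\mathbf g]P[m-n-k,-n+1,\mathbf h]\bigr),\quad m\ge0,$$ and $$\mathbf g=(1+a_1^N,a_2^N,a_3^N,\dots),\quad \mathbf h=(2,a_1^N-1,a_2^N,a_3^N,\dots),$$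 $$\tilde{\mathbf g}=(1-a_1^N,-a_2^N,-a_3^N,\dots),\quad \tilde{\mathbf h}=(2,1+a_1^N,a_2^N,a_3^N,\dots).$$ Moreover, if $t\neq0$, then $(a_m^R)_{m\ge0}$ is the only sequence of coefficients with which $\mathcal R(K,M,N)(x-t,x+t)$ has an expansion of this form. For $t=0$ the expansion is just $\mathcal R(K,M,N)(x,x)=x$; there $0^0=1$, $P[0,0,\mathbf a]=1$ and $1/0$ is read as $0$. -/

import Mathlib

open Filter Asymptotics

noncomputable section

/-- A bivariate mean: a function on pairs of positive reals lying between the minimum and the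
maximum of its arguments. Values outside the positive quadrant are irrelevant. -/
def IsMean (M : ℝ → ℝ → ℝ) : Prop :=
  ∀ s t : ℝ, 0 < s → 0 < t → min s t ≤ M s t ∧ M s t ≤ max s t

/-- Homogeneity of degree one on pairs of positive reals. -/
def IsHomogeneous (M : ℝ → ℝ → ℝ) : Prop :=
  ∀ c s t : ℝ, 0 < c → 0 < s → 0 < t → M (c * s) (c * t) = c * M s t

/-- The resultant mean-map of `K`, `M`, `N`. -/
def resultant (K M N : ℝ → ℝ → ℝ) (s t : ℝ) : ℝ :=
  K (M s (N s t)) (M (N s t) t)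

/-- The series `∑ aₙ φₙ` is an asymptotic expansion of `f` along the filter `l`. -/
def IsAsymptoticExpansion (l : Filter ℝ) (φ : ℕ → ℝ → ℝ) (a : ℕ → ℝ) (f : ℝ → ℝ) : Prop :=
  ∀ n : ℕ, (fun x => f x - ∑ k ∈ Finset.range (n + 1), a k * φ k x) =o[l] φ n

/-- `M (x - t, x + t) ∼ ∑ aₙ tⁿ x ^ (1 - n)` as `x → ∞`, for the given `t`. -/
def HasExpansionAt (M : ℝ → ℝ → ℝ) (t : ℝ) (a : ℕ → ℝ) : Prop :=
  IsAsymptoticExpansion atTop (fun n x => x ^ (1 - (n : ℤ))) (fun n => a n * t ^ n)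
    (fun x => M (x - t) (x + t))

/-- The coefficient `P[n, r, a]` of the `r`-th power of the series with coefficients `a`,
given by its recursion; see `powCoeff_eq` for the usual indexing of the sum. -/
def powCoeff (r : ℝ) (a : ℕ → ℝ) : ℕ → ℝ
  | 0 => a 0 ^ r
  | n + 1 => 1 / (((n + 1 : ℕ) : ℝ) * a 0) *
      ∑ j : Fin (n + 1), ((((j : ℕ) + 1 : ℕ) : ℝ) * (1 + r) - ((n + 1 : ℕ) : ℝ)) *
        a ((j : ℕ) + 1) * powCoeff r a (n - (j : ℕ))
termination_by n => n
decreasing_by omega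

theorem powCoeff_zero (r : ℝ) (a : ℕ → ℝ) : powCoeff r a 0 = a 0 ^ r := by
  rw [powCoeff]

theorem powCoeff_eq (r : ℝ) (a : ℕ → ℝ) (n : ℕ) (hn : 1 ≤ n) :
    powCoeff r a n = 1 / ((n : ℝ) * a 0) *
      ∑ k ∈ Finset.Icc 1 n, ((k : ℝ) * (1 + r) - (n : ℝ)) * a k * powCoeff r a (n - k) := by
  obtain ⟨m, rfl⟩ : ∃ m, n = m + 1 := ⟨n - 1, by omega⟩
  have hI : Finset.Icc 1 (m + 1) = Finset.Ico 1 (m + 1 + 1) := by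
    ext k; simp only [Finset.mem_Icc, Finset.mem_Ico]; omega
  rw [powCoeff, hI, Finset.sum_Ico_eq_sum_range, Nat.add_sub_cancel,
    ← Fin.sum_univ_eq_sum_range (fun i => (((1 + i : ℕ) : ℝ) * (1 + r) - ((m + 1 : ℕ) : ℝ)) *
      a (1 + i) * powCoeff r a (m + 1 - (1 + i)))]
  congr 1
  refine Finset.sum_congr rfl fun j _ => ?_
  rw [Nat.add_comm 1 (j : ℕ), Nat.add_sub_add_right]

/-- `g = (1 + a₁, a₂, a₃, …)`. -/
def seqG (a : ℕ → ℝ) (n : ℕ) : ℝ := if n = 0 then 1 + a 1 else a (n + 1)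

/-- `h = (2, a₁ - 1, a₂, a₃, …)`. -/
def seqH (a : ℕ → ℝ) (n : ℕ) : ℝ := if n = 0 then 2 else if n = 1 then a 1 - 1 else a n

/-- `g̃ = (1 - a₁, -a₂, -a₃, …)`. -/
def seqG' (a : ℕ → ℝ) (n : ℕ) : ℝ := if n = 0 then 1 - a 1 else -a (n + 1)

/-- `h̃ = (2, 1 + a₁, a₂, a₃, …)`. -/
def seqH' (a : ℕ → ℝ) (n : ℕ) : ℝ := if n = 0 then 2 else if n = 1 then 1 + a 1 else a n

/-- The sequence `d`; its term `d j` is the term `d_{m-1}` with `m = j + 1`. -/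
def seqD (aM aN : ℕ → ℝ) (j : ℕ) : ℝ :=
  ∑ n ∈ Finset.range (j + 1 + 1), aM n * ∑ k ∈ Finset.range (j + 1 - n + 1),
    (powCoeff n (seqG' aN) k * powCoeff (-(n : ℝ) + 1) (seqH' aN) (j + 1 - n - k)
      - powCoeff n (seqG aN) k * powCoeff (-(n : ℝ) + 1) (seqH aN) (j + 1 - n - k))

/-- The sequence `s`. -/
def seqS (aM aN : ℕ → ℝ) (m : ℕ) : ℝ :=
  ∑ n ∈ Finset.range (m + 1), aM n * ∑ k ∈ Finset.range (m - n + 1),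
    (powCoeff n (seqG' aN) k * powCoeff (-(n : ℝ) + 1) (seqH' aN) (m - n - k)
      + powCoeff n (seqG aN) k * powCoeff (-(n : ℝ) + 1) (seqH aN) (m - n - k))

/-- The coefficients of the expansion of the resultant mean-map. -/
def resultantCoeff (aK aM aN : ℕ → ℝ) (m : ℕ) : ℝ :=
  1 / 4 * ∑ n ∈ Finset.range (m + 1), ∑ k ∈ Finset.range (m - n + 1),
    aK n * powCoeff n (seqD aM aN) k * powCoeff (-(n : ℝ) + 1) (seqS aM aN) (m - n - k)

end

/-!
Put `u = t / x` with `t ≠ 0`. By homogeneity `M (x - t) (x + t) = x * M (1 - u) (1 + u)`, so an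
expansion of a homogeneous mean is the same thing as an asymptotic power series of
`M (1 - u) (1 + u)` in the small quantity `u` (`hasExpansionAt_iff`). Functions with an asymptotic
power series in `u` (`AsympSeries`) form a ring on which taking the series is a homomorphism; it is
compatible with inverses and with division by `u`, and the series is unique.

The resultant is computed by one composition rule (`asympSeries_mean_comp`): if `g ∼ G` and `h ∼ H`
with positive constant terms, then
`M (h - u g) (h + u g) = h * M (1 - w) (1 + w)` with `w = u g / h = t / (x h / g)`, and
`x h / g → ∞`, so the expansion of `M` may be used at the point `x h / g`. It gives the series
`∑ aₙ uⁿ Gⁿ H ^ (1 - n)` (`homogComp`). The powers of `G` and `H` have the coefficients `powCoeff`,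
because `F = A ^ r` is determined by `A F' = r A' F` and its constant term (`coeff_eq_powCoeff`).

The rule is used three times. The pairs `(1 - u, N)` and `(N, 1 + u)`, scaled by `2`, are of the
form `(h - u g, h + u g)` for the sequences `seqG`, `seqH` and `seqG'`, `seqH'`. The difference
(divided by `u`) and the sum of the two resulting functions have the sequences `seqD` and `seqS`,
and bring the pair given to `K`, scaled by `4`, into the same form. The constant terms which have
to be positive are `1 + a₁`, `1 - a₁`, `2`, `4` and `2 (1 - b₁ a₁)`, where `a₁` and `b₁` belong to
`N` and `M`. They are positive because the first coefficient of a mean has absolute value at most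
`1` (`abs_coeff_one_le_of_isMean`) and `a₁ ≠ ±1`.

For `t = 0` every expansion only asserts that its leading coefficient is `1`
(`hasExpansionAt_zero_iff`).
-/

section

open PowerSeries

/-! ### Asymptotic power series in a small function -/

/-- `F` has the asymptotic power series `A` in `u` along `l`: up to `O(u ^ n)`, for every `n`, it is
a polynomial in `u` that agrees with `A` modulo `X ^ n`. Any such polynomial will do, not just the
truncation of `A`, which makes products immediate; see `AsympSeries.isBigO_sub`. -/
def AsympSeries {α : Type*} (l : Filter α) (u F : α → ℝ) (A : PowerSeries ℝ) : Prop :=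
  ∀ n : ℕ, ∃ p : Polynomial ℝ, (X : PowerSeries ℝ) ^ n ∣ A - p ∧
    (fun x => F x - p.eval (u x)) =O[l] fun x => u x ^ n

theorem isBigO_eval_of_X_pow_dvd {α : Type*} {l : Filter α} {u : α → ℝ}
    (hu : Tendsto u l (nhds 0)) {n : ℕ} {p : Polynomial ℝ}
    (hp : (X : PowerSeries ℝ) ^ n ∣ (p : PowerSeries ℝ)) :
    (fun x => p.eval (u x)) =O[l] fun x => u x ^ n := by
  have hp' : (Polynomial.X : Polynomial ℝ) ^ n ∣ p := by
    rw [Polynomial.X_pow_dvd_iff]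
    rw [PowerSeries.X_pow_dvd_iff] at hp
    simpa using hp
  obtain ⟨q, rfl⟩ := hp'
  have hq : (fun x => q.eval (u x)) =O[l] fun _ => (1 : ℝ) :=
    ((q.continuous.tendsto 0).comp hu).isBigO_one ℝ
  simpa using (isBigO_refl (fun x => u x ^ n) l).mul hq

theorem X_pow_dvd_sub_trunc (A : PowerSeries ℝ) {m n : ℕ} (h : m ≤ n) :
    (X : PowerSeries ℝ) ^ m ∣ A - (trunc n A : Polynomial ℝ) := by
  rw [PowerSeries.X_pow_dvd_iff]
  intro k hk
  simp [coeff_trunc, hk.trans_le h]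

namespace AsympSeries

variable {α : Type*} {l : Filter α} {u F G : α → ℝ} {A B : PowerSeries ℝ}

/-- The polynomial in the definition may be replaced by any other one with the same residue. -/
theorem isBigO_sub (hu : Tendsto u l (nhds 0)) (h : AsympSeries l u F A) {n : ℕ}
    {p : Polynomial ℝ} (hp : (X : PowerSeries ℝ) ^ n ∣ A - p) :
    (fun x => F x - p.eval (u x)) =O[l] fun x => u x ^ n := by
  obtain ⟨q, hq, hF⟩ := h n
  have hd : (X : PowerSeries ℝ) ^ n ∣ ((q - p : Polynomial ℝ) : PowerSeries ℝ) := by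
    have := dvd_sub hp hq
    simpa using this
  refine (hF.add (isBigO_eval_of_X_pow_dvd hu hd)).congr_left fun x => ?_
  simp

theorem isBigO_pow (hu : Tendsto u l (nhds 0)) (h : AsympSeries l u F A) {n : ℕ}
    (hA : (X : PowerSeries ℝ) ^ n ∣ A) : F =O[l] fun x => u x ^ n := by
  simpa using h.isBigO_sub hu (p := 0) (by simpa using hA)

theorem isBigO_one (hu : Tendsto u l (nhds 0)) (h : AsympSeries l u F A) :
    F =O[l] fun _ => (1 : ℝ) := by
  simpa using h.isBigO_pow hu (n := 0) (by simp)

theorem congr' (h : AsympSeries l u F A) (hFG : F =ᶠ[l] G) : AsympSeries l u G A := by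
  intro n
  obtain ⟨p, hp, hF⟩ := h n
  refine ⟨p, hp, hF.congr' ?_ EventuallyEq.rfl⟩
  filter_upwards [hFG] with x hx
  rw [hx]

theorem polynomial (p : Polynomial ℝ) : AsympSeries l u (fun x => p.eval (u x)) p := fun n =>
  ⟨p, by simp, by simpa using isBigO_zero _ _⟩

theorem self : AsympSeries l u u X := by
  simpa using polynomial (l := l) (u := u) Polynomial.X

theorem one : AsympSeries l u (fun _ => 1) 1 := by
  simpa using polynomial (l := l) (u := u) 1

theorem add (hF : AsympSeries l u F A) (hG : AsympSeries l u G B) :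
    AsympSeries l u (fun x => F x + G x) (A + B) := by
  intro n
  obtain ⟨p, hp, hFp⟩ := hF n
  obtain ⟨q, hq, hGq⟩ := hG n
  refine ⟨p + q, ?_, (hFp.add hGq).congr_left fun x => ?_⟩
  · convert dvd_add hp hq using 1
    push_cast
    ring
  · simp only [Polynomial.eval_add]
    ring

theorem sub (hF : AsympSeries l u F A) (hG : AsympSeries l u G B) :
    AsympSeries l u (fun x => F x - G x) (A - B) := by
  intro n
  obtain ⟨p, hp, hFp⟩ := hF n
  obtain ⟨q, hq, hGq⟩ := hG n
  refine ⟨p - q, ?_, (hFp.sub hGq).congr_left fun x => ?_⟩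
  · convert dvd_sub hp hq using 1
    push_cast
    ring
  · simp only [Polynomial.eval_sub]
    ring

theorem mul (hu : Tendsto u l (nhds 0)) (hF : AsympSeries l u F A) (hG : AsympSeries l u G B) :
    AsympSeries l u (fun x => F x * G x) (A * B) := by
  intro n
  obtain ⟨p, hp, hFp⟩ := hF n
  obtain ⟨q, hq, hGq⟩ := hG n
  refine ⟨p * q, ?_, ?_⟩
  · convert dvd_add (hp.mul_right B) (hq.mul_left (p : PowerSeries ℝ)) using 1
    push_cast
    ring
  · have h1 := hFp.mul (hG.isBigO_one hu)
    have h2 := ((polynomial (l := l) (u := u) p).isBigO_one hu).mul hGq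
    simp only [mul_one, one_mul] at h1 h2
    refine (h1.add h2).congr_left fun x => ?_
    simp only [Polynomial.eval_mul]
    ring

theorem pow (hu : Tendsto u l (nhds 0)) (hF : AsympSeries l u F A) (n : ℕ) :
    AsympSeries l u (fun x => F x ^ n) (A ^ n) := by
  induction n with
  | zero => simpa using one
  | succ n ih => simpa only [pow_succ] using ih.mul hu hF

theorem tendsto (hu : Tendsto u l (nhds 0)) (hF : AsympSeries l u F A) :
    Tendsto F l (nhds (constantCoeff A)) := by
  have h : (fun x => F x - constantCoeff A) =O[l] fun x => u x ^ 1 := by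
    simpa using hF.isBigO_sub hu (n := 1) (p := Polynomial.C (constantCoeff A)) (by
      rw [pow_one, X_dvd_iff]; simp)
  simp only [pow_one] at h
  simpa using (h.trans_tendsto hu).add_const (constantCoeff A)

/-- With `q` a truncation of `A⁻¹`, `F⁻¹ - q(u) = F⁻¹ (1 - F q(u))`, where `1 - A q` is divisible by
`X ^ n`. -/
theorem inv (hu : Tendsto u l (nhds 0)) (hF : AsympSeries l u F A) (hA : constantCoeff A ≠ 0) :
    AsympSeries l u (fun x => (F x)⁻¹) A⁻¹ := by
  intro n
  refine ⟨trunc n A⁻¹, X_pow_dvd_sub_trunc _ le_rfl, ?_⟩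
  have hT := hF.tendsto hu
  have hd : (X : PowerSeries ℝ) ^ n ∣ 1 - A * (trunc n A⁻¹ : Polynomial ℝ) := by
    convert (X_pow_dvd_sub_trunc A⁻¹ (le_refl n)).mul_left A using 1
    rw [mul_sub, PowerSeries.mul_inv_cancel _ hA]
  have h1 := (one.sub (hF.mul hu (polynomial (trunc n A⁻¹)))).isBigO_pow hu hd
  have h2 : (fun x => (F x)⁻¹) =O[l] fun _ => (1 : ℝ) := (hT.inv₀ hA).isBigO_one ℝ
  have h3 := h2.mul h1
  simp only [one_mul] at h3
  refine h3.congr' ?_ EventuallyEq.rfl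
  filter_upwards [hT.eventually_ne hA] with x hx
  field_simp

theorem div_X (hu : Tendsto u l (nhds 0)) (hu0 : ∀ᶠ x in l, u x ≠ 0)
    (hF : AsympSeries l u F (X * A)) : AsympSeries l u (fun x => F x / u x) A := by
  intro n
  refine ⟨trunc n A, X_pow_dvd_sub_trunc _ le_rfl, ?_⟩
  have h := hF.isBigO_sub hu (n := n + 1) (p := Polynomial.X * trunc n A) (by
    rw [pow_succ']
    convert mul_dvd_mul_left X (X_pow_dvd_sub_trunc A (le_refl n)) using 1
    push_cast
    ring)
  refine ((isBigO_refl (fun x => (u x)⁻¹) l).mul h).congr' ?_ ?_ <;>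
    filter_upwards [hu0] with x hx
  · simp only [Polynomial.eval_mul, Polynomial.eval_X]
    field_simp
  · rw [pow_succ']
    field_simp

theorem eq_zero [l.NeBot] (hu : Tendsto u l (nhds 0)) (hu0 : ∀ᶠ x in l, u x ≠ 0)
    (h : AsympSeries l u (fun _ => 0) A) : A = 0 := by
  have key : ∀ (n : ℕ) (A : PowerSeries ℝ), AsympSeries l u (fun _ => 0) A → coeff n A = 0 := by
    intro n
    induction n with
    | zero =>
      intro A h
      rw [coeff_zero_eq_constantCoeff_apply]
      exact tendsto_nhds_unique (h.tendsto hu) tendsto_const_nhds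
    | succ n ih =>
      intro A h
      obtain ⟨B, rfl⟩ := X_dvd_iff.2 (tendsto_nhds_unique (h.tendsto hu) tendsto_const_nhds)
      rw [coeff_succ_X_mul]
      exact ih B (by simpa using h.div_X hu hu0)
  ext n
  simpa using key n A h

theorem unique [l.NeBot] (hu : Tendsto u l (nhds 0)) (hu0 : ∀ᶠ x in l, u x ≠ 0)
    (hA : AsympSeries l u F A) (hB : AsympSeries l u F B) : A = B :=
  sub_eq_zero.1 (eq_zero hu hu0 (by simpa using hA.sub hB))

theorem comp_tendsto {β : Type*} {l' : Filter β} {y : β → α} (hF : AsympSeries l u F A)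
    (hy : Tendsto y l' l) : AsympSeries l' (u ∘ y) (F ∘ y) A := fun n =>
  let ⟨p, hp, h⟩ := hF n
  ⟨p, hp, h.comp_tendsto hy⟩

theorem eval_polynomial (hu : Tendsto u l (nhds 0)) (hF : AsympSeries l u F A) (p : Polynomial ℝ) :
    AsympSeries l u (fun x => p.eval (F x)) (Polynomial.aeval A p) := by
  induction p using Polynomial.induction_on' with
  | add p q hp hq => simpa using hp.add hq
  | monomial n a =>
    have := (polynomial (l := l) (u := u) (Polynomial.C a)).mul hu (hF.pow hu n)
    simpa [Polynomial.aeval_monomial] using this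

end AsympSeries

/-! ### Substitution into an asymptotic power series -/

/-- The series `∑ aₙ Xⁿ Gⁿ H ^ (1 - n)`, that is, `H` times the series of `a` at `X G / H`. The
power `H ^ (1 - n)` is written `H * H⁻¹ ^ n`; the inverse is `0` if `H` has constant term `0`. -/
noncomputable def homogComp (a : ℕ → ℝ) (G H : PowerSeries ℝ) : PowerSeries ℝ :=
  mk fun m => ∑ n ∈ Finset.range (m + 1), a n * coeff (m - n) (G ^ n * (H * H⁻¹ ^ n))

theorem X_pow_dvd_homogComp_sub (a : ℕ → ℝ) (G H : PowerSeries ℝ) (N : ℕ) :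
    (X : PowerSeries ℝ) ^ N ∣
      homogComp a G H - H * Polynomial.aeval (X * G * H⁻¹) (trunc N (mk a)) := by
  rw [PowerSeries.X_pow_dvd_iff]
  intro m hm
  have h : H * Polynomial.aeval (X * G * H⁻¹) (trunc N (mk a)) =
      ∑ n ∈ Finset.range N, C (a n) * (G ^ n * (H * H⁻¹ ^ n) * X ^ n) := by
    rw [trunc_apply, map_sum, Finset.mul_sum, Nat.Ico_zero_eq_range]
    refine Finset.sum_congr rfl fun n _ => ?_
    rw [Polynomial.aeval_monomial, coeff_mk]
    change H * (C (a n) * _) = _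
    ring
  rw [map_sub, h, map_sum, homogComp, coeff_mk, sub_eq_zero]
  simp only [coeff_C_mul, coeff_mul_X_pow', mul_ite, mul_zero]
  rw [← Finset.sum_filter]
  refine Finset.sum_congr ?_ fun _ _ => rfl
  ext n
  simp only [Finset.mem_range, Finset.mem_filter]
  omega

theorem AsympSeries.homogComp {α : Type*} {l : Filter α} {u φ g h : α → ℝ} {a : ℕ → ℝ}
    {G H : PowerSeries ℝ} (hu : Tendsto u l (nhds 0))
    (hg : AsympSeries l u g G) (hh : AsympSeries l u h H) (hH : constantCoeff H ≠ 0)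
    (hφ : AsympSeries l (fun x => u x * g x * (h x)⁻¹) φ (mk a)) :
    AsympSeries l u (fun x => h x * φ x) (homogComp a G H) := by
  have hW := (AsympSeries.self.mul hu hg).mul hu (hh.inv hu hH)
  have hw0 : Tendsto (fun x => u x * g x * (h x)⁻¹) l (nhds 0) := by
    simpa using hW.tendsto hu
  -- `X G H⁻¹` is divisible by `X`, so an error `O(w ^ n)` with `w = u g / h` is `O(u ^ n)`.
  have hwO := hW.isBigO_pow hu (n := 1) (by rw [pow_one, mul_assoc]; exact dvd_mul_right _ _)
  simp only [pow_one] at hwO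
  intro n
  have h1 := hφ.isBigO_sub hw0 (X_pow_dvd_sub_trunc (mk a) (le_refl n))
  have h2 := (hh.isBigO_one hu).mul (h1.trans (hwO.pow n))
  have h3 := hh.mul hu (hW.eval_polynomial hu (trunc n (mk a)))
  obtain ⟨p, hp, hpO⟩ := h3 n
  refine ⟨p, ?_, ?_⟩
  · convert dvd_add (X_pow_dvd_homogComp_sub a G H n) hp using 1
    ring
  · simp only [one_mul] at h2
    refine (h2.add hpO).congr_left fun x => ?_
    ring

/-! ### Coefficients of powers of a power series -/

/-- The equation `A F' = r A' F`, satisfied by `F = A ^ r`, is the recursion of `powCoeff` when read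
off coefficient by coefficient. -/
theorem coeff_eq_powCoeff (A F : PowerSeries ℝ) (r : ℝ) (hA : constantCoeff A ≠ 0)
    (hF0 : constantCoeff F = constantCoeff A ^ r)
    (hF : A * d⁄dX ℝ F = r • (d⁄dX ℝ A * F)) (n : ℕ) :
    coeff n F = powCoeff r (fun k => coeff k A) n := by
  induction n using Nat.strong_induction_on with
  | _ n ih =>
  rcases Nat.eq_zero_or_pos n with rfl | hn
  · simpa [powCoeff_zero] using hF0
  -- Multiplying by `X` makes the `k`-th coefficient of the derivative `k` times that of the series.
  have hX : A * (X * d⁄dX ℝ F) = r • ((X * d⁄dX ℝ A) * F) := by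
    rw [mul_left_comm, hF, mul_assoc, mul_smul_comm]
  have hcoeff : ∀ (B : PowerSeries ℝ) (k : ℕ), coeff k (X * d⁄dX ℝ B) = k * coeff k B := by
    intro B k
    cases k with
    | zero => simp
    | succ k => rw [coeff_succ_X_mul, coeff_derivative]; push_cast; ring
  have h := congrArg (coeff n) hX
  rw [map_smul, coeff_mul, coeff_mul, Finset.Nat.sum_antidiagonal_eq_sum_range_succ_mk,
    Finset.Nat.sum_antidiagonal_eq_sum_range_succ_mk] at h
  simp only [hcoeff, smul_eq_mul, Finset.mul_sum] at h
  rw [← sub_eq_zero, ← Finset.sum_sub_distrib, Finset.sum_range_succ'] at h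
  have hn0 : (n : ℝ) ≠ 0 := by positivity
  have hA' : coeff 0 A ≠ 0 := by simpa using hA
  have hI : Finset.Icc 1 n = Finset.Ico 1 (n + 1) := by
    ext k; simp only [Finset.mem_Icc, Finset.mem_Ico]; omega
  rw [powCoeff_eq _ _ _ hn, one_div, eq_inv_mul_iff_mul_eq₀ (mul_ne_zero hn0 hA'), hI,
    Finset.sum_Ico_eq_sum_range, Nat.add_sub_cancel]
  simp only [Nat.sub_zero, Nat.cast_zero, zero_mul, mul_zero, sub_zero] at h
  rw [add_comm] at h
  have h' := eq_neg_of_add_eq_zero_left h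
  rw [show (n : ℝ) * coeff 0 A * coeff n F = coeff 0 A * (n * coeff n F) by ring, h',
    ← Finset.sum_neg_distrib]
  refine Finset.sum_congr rfl fun k hk => ?_
  have hk' := Finset.mem_range.1 hk
  rw [← ih (n - (1 + k)) (by omega), Nat.add_comm 1 k, Nat.cast_sub (by omega)]
  ring

theorem coeff_pow_eq_powCoeff (A : PowerSeries ℝ) (hA : constantCoeff A ≠ 0) (r k : ℕ) :
    coeff k (A ^ r) = powCoeff r (fun k => coeff k A) k := by
  refine coeff_eq_powCoeff A _ r hA (by simp) ?_ k
  induction r with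
  | zero => simp
  | succ r ih =>
    rw [pow_succ, Derivation.leibniz, mul_add]
    simp only [smul_eq_mul]
    rw [mul_left_comm A A, ih]
    simp only [smul_eq_C_mul, Nat.cast_add, Nat.cast_one, map_add, map_one]
    ring

theorem coeff_mul_inv_pow_eq_powCoeff (A : PowerSeries ℝ) (hA : constantCoeff A ≠ 0) (r k : ℕ) :
    coeff k (A * A⁻¹ ^ r) = powCoeff (-(r : ℝ) + 1) (fun k => coeff k A) k := by
  refine coeff_eq_powCoeff A _ _ hA ?_ ?_ k
  · rw [Real.rpow_add_one hA, Real.rpow_neg_natCast]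
    simp [mul_comm]
  induction r with
  | zero => simp [mul_comm]
  | succ r ih =>
    rw [pow_succ, ← mul_assoc, Derivation.leibniz, mul_add, derivative_inv']
    simp only [smul_eq_mul]
    rw [mul_left_comm A A⁻¹, ih]
    have h : A * A⁻¹ = 1 := PowerSeries.mul_inv_cancel _ hA
    simp only [smul_eq_C_mul, Nat.cast_add, Nat.cast_one, map_add, map_one, map_neg]
    linear_combination (-(A * A⁻¹ ^ r) * A⁻¹ * d⁄dX ℝ A) * h

/-! ### Expansions of homogeneous means -/

theorem tendsto_const_div_atTop_zero (t : ℝ) : Tendsto (fun x : ℝ => t / x) atTop (nhds 0) :=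
  tendsto_const_nhds.div_atTop tendsto_id

theorem eventually_const_div_ne_zero {t : ℝ} (ht : t ≠ 0) : ∀ᶠ x : ℝ in atTop, t / x ≠ 0 := by
  filter_upwards [eventually_gt_atTop 0] with x hx
  exact div_ne_zero ht hx.ne'

theorem eval_trunc_mk (a : ℕ → ℝ) (n : ℕ) (v : ℝ) :
    (trunc n (mk a)).eval v = ∑ k ∈ Finset.range n, a k * v ^ k := by
  rw [trunc_apply, Polynomial.eval_finsetSum, Nat.Ico_zero_eq_range]
  simp [Polynomial.eval_monomial]

/-- Division by `x` turns an expansion in the powers `tⁿ x ^ (1 - n)` into an asymptotic power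
series in `t / x`. -/
theorem hasExpansionAt_iff {M : ℝ → ℝ → ℝ} (hM : IsHomogeneous M) {t : ℝ} (ht : t ≠ 0)
    (a : ℕ → ℝ) :
    HasExpansionAt M t a ↔ AsympSeries atTop (fun x => t / x)
      (fun x => M (1 - t / x) (1 + t / x)) (mk a) := by
  have hu := tendsto_const_div_atTop_zero t
  have key : ∀ n : ℕ,
      (fun x => M (x - t) (x + t) - ∑ k ∈ Finset.range (n + 1), a k * t ^ k * x ^ (1 - (k : ℤ)))
        =ᶠ[atTop] fun x => x *
          (M (1 - t / x) (1 + t / x) - (trunc (n + 1) (mk a)).eval (t / x)) := by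
    intro n
    filter_upwards [eventually_gt_atTop |t|] with x hx
    have hx0 : 0 < x := (abs_nonneg t).trans_lt hx
    obtain ⟨hx1, hx2⟩ := abs_lt.1 hx
    have e1 : x - t = x * (1 - t / x) := by field_simp
    have e2 : x + t = x * (1 + t / x) := by field_simp
    have p1 : 0 < 1 - t / x := by rw [sub_pos, div_lt_one hx0]; exact hx2
    have p2 : 0 < 1 + t / x := by
      have : -1 < t / x := by rw [lt_div_iff₀ hx0]; linarith
      linarith
    rw [e1, e2, hM x _ _ hx0 p1 p2, mul_sub, eval_trunc_mk, Finset.mul_sum]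
    congr 1
    refine Finset.sum_congr rfl fun k _ => ?_
    rw [zpow_sub₀ hx0.ne', zpow_one, zpow_natCast, div_pow]
    ring
  constructor
  · intro h n
    refine ⟨trunc (n + 1) (mk a), X_pow_dvd_sub_trunc _ n.le_succ, ?_⟩
    have h1 := ((h n).congr' (key n) EventuallyEq.rfl).isBigO
    have h2 := (isBigO_refl (fun x : ℝ => x⁻¹) atTop).mul h1
    have h3 : (fun x : ℝ => x⁻¹ * x ^ (1 - (n : ℤ))) =O[atTop] fun x => (t / x) ^ n := by
      refine (isBigO_const_mul_self (t ^ n)⁻¹ (fun x : ℝ => (t / x) ^ n) atTop).congr' ?_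
        EventuallyEq.rfl
      filter_upwards [eventually_gt_atTop 0] with x hx
      rw [zpow_sub₀ hx.ne', zpow_one, zpow_natCast, div_pow]
      field_simp
    refine (h2.trans h3).congr' ?_ EventuallyEq.rfl
    filter_upwards [eventually_gt_atTop 0] with x hx
    field_simp
  · intro h n
    refine IsLittleO.congr' ?_ (key n).symm EventuallyEq.rfl
    have h1 := h.isBigO_sub hu (X_pow_dvd_sub_trunc (mk a) (le_refl (n + 1)))
    have h2 : (fun x : ℝ => (t / x) ^ (n + 1)) =o[atTop] fun x => (t / x) ^ n := by
      have := ((isLittleO_one_iff ℝ).2 hu).mul_isBigO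
        (isBigO_refl (fun x : ℝ => (t / x) ^ n) atTop)
      simpa only [pow_succ', one_mul] using this
    have h3 := (isBigO_refl (fun x : ℝ => x) atTop).mul_isLittleO (h1.trans_isLittleO h2)
    refine h3.trans_isBigO ((isBigO_const_mul_self (t ^ n)
      (fun x : ℝ => x ^ (1 - (n : ℤ))) atTop).congr' ?_ EventuallyEq.rfl)
    filter_upwards [eventually_gt_atTop 0] with x hx
    rw [zpow_sub₀ hx.ne', zpow_one, zpow_natCast, div_pow]
    ring

theorem IsMean.pos {M : ℝ → ℝ → ℝ} (hM : IsMean M) {s t : ℝ} (hs : 0 < s) (ht : 0 < t) :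
    0 < M s t :=
  (lt_min hs ht).trans_le (hM s t hs ht).1

theorem IsMean.self {M : ℝ → ℝ → ℝ} (hM : IsMean M) {s : ℝ} (hs : 0 < s) : M s s = s :=
  le_antisymm (by simpa using (hM s s hs hs).2) (by simpa using (hM s s hs hs).1)

theorem isHomogeneous_resultant {K M N : ℝ → ℝ → ℝ} (hM : IsMean M) (hN : IsMean N)
    (hK' : IsHomogeneous K) (hM' : IsHomogeneous M) (hN' : IsHomogeneous N) :
    IsHomogeneous (resultant K M N) := by
  intro c s t hc hs ht
  have h := hN.pos hs ht
  rw [resultant, hN' c s t hc hs ht, hM' c s _ hc hs h, hM' c _ t hc h ht,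
    hK' c _ _ hc (hM.pos hs h) (hM.pos h ht), resultant]

theorem IsMean.abs_sub_one_le {M : ℝ → ℝ → ℝ} (hM : IsMean M) {v : ℝ} (hv : |v| < 1) :
    |M (1 - v) (1 + v) - 1| ≤ |v| := by
  obtain ⟨h1, h2⟩ := abs_lt.1 hv
  obtain ⟨h3, h4⟩ := hM (1 - v) (1 + v) (by linarith) (by linarith)
  rw [abs_sub_le_iff]
  constructor
  · have := max_le (a := 1 - v) (b := 1 + v) (c := 1 + |v|)
      (by linarith [neg_abs_le v]) (by linarith [le_abs_self v])
    linarith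
  · have := le_min (a := 1 - v) (b := 1 + v) (c := 1 - |v|)
      (by linarith [le_abs_self v]) (by linarith [neg_abs_le v])
    linarith

theorem eventually_abs_const_div_lt_one (t : ℝ) : ∀ᶠ x : ℝ in atTop, |t / x| < 1 := by
  filter_upwards [(tendsto_const_div_atTop_zero t).eventually (Metric.ball_mem_nhds 0 one_pos)]
    with x hx
  rwa [Real.dist_0_eq_abs] at hx

theorem coeff_zero_of_isMean {M : ℝ → ℝ → ℝ} (hM : IsMean M) {t : ℝ} {a : ℕ → ℝ}
    (h : AsympSeries atTop (fun x => t / x) (fun x => M (1 - t / x) (1 + t / x)) (mk a)) :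
    a 0 = 1 := by
  have hu := tendsto_const_div_atTop_zero t
  have h0 : Tendsto (fun x => M (1 - t / x) (1 + t / x) - 1) atTop (nhds 0) :=
    squeeze_zero_norm' ((eventually_abs_const_div_lt_one t).mono fun x hx =>
      hM.abs_sub_one_le hx) (by simpa using hu.abs)
  have h1 := (h.sub AsympSeries.one).tendsto hu
  have := tendsto_nhds_unique h1 h0
  rw [map_sub, ← coeff_zero_eq_constantCoeff_apply, coeff_mk, map_one] at this
  linarith

/-- The first coefficient is the limit of `(M (1 - u) (1 + u) - 1) / u`, and a mean of `1 - u` and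
`1 + u` has distance at most `|u|` from `1`. -/
theorem abs_coeff_one_le_of_isMean {M : ℝ → ℝ → ℝ} (hM : IsMean M) {t : ℝ} (ht : t ≠ 0)
    {a : ℕ → ℝ}
    (h : AsympSeries atTop (fun x => t / x) (fun x => M (1 - t / x) (1 + t / x)) (mk a)) :
    |a 1| ≤ 1 := by
  have hu := tendsto_const_div_atTop_zero t
  have hX : mk a - 1 = X * mk fun n => a (n + 1) := by
    ext n
    cases n with
    | zero => simp [coeff_zero_of_isMean hM h]
    | succ n => simp [coeff_succ_X_mul, coeff_one]
  have h1 := ((hX ▸ h.sub AsympSeries.one).div_X hu (eventually_const_div_ne_zero ht)).tendsto hu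
  rw [← coeff_zero_eq_constantCoeff_apply, coeff_mk, zero_add] at h1
  refine le_of_tendsto h1.abs ?_
  filter_upwards [eventually_abs_const_div_lt_one t] with x hx
  rw [abs_div]
  exact div_le_one_of_le₀ (hM.abs_sub_one_le hx) (abs_nonneg _)

/-- The expansion of a homogeneous mean at a pair with half sum `h` and half difference `u g`. The
signs of the constant terms matter: the expansion of `M` holds at `+∞` only, so `x h / g` has to
tend there. -/
theorem asympSeries_mean_comp {M : ℝ → ℝ → ℝ} (hM : IsHomogeneous M) {t : ℝ} {a : ℕ → ℝ}
    (ha : AsympSeries atTop (fun x => t / x) (fun x => M (1 - t / x) (1 + t / x)) (mk a))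
    {g h : ℝ → ℝ} {G H : PowerSeries ℝ}
    (hg : AsympSeries atTop (fun x => t / x) g G) (hh : AsympSeries atTop (fun x => t / x) h H)
    (hG : 0 < constantCoeff G) (hH : 0 < constantCoeff H) :
    AsympSeries atTop (fun x => t / x)
      (fun x => M (h x - t / x * g x) (h x + t / x * g x)) (homogComp a G H) := by
  have hu := tendsto_const_div_atTop_zero t
  have hgt := hg.tendsto hu
  have hht := hh.tendsto hu
  have hy : Tendsto (fun x => x * (h x / g x)) atTop atTop :=
    tendsto_id.atTop_mul_pos (div_pos hH hG) (hht.div hgt hG.ne')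
  have hw : (fun x => t / x) ∘ (fun x => x * (h x / g x)) = fun x => t / x * g x * (h x)⁻¹ := by
    funext x
    simp only [Function.comp, div_eq_mul_inv, mul_inv, inv_inv]
    ring
  have hc := ha.comp_tendsto hy
  rw [hw] at hc
  refine (AsympSeries.homogComp hu hg hh hH.ne' hc).congr' ?_
  filter_upwards [hht.eventually (lt_mem_nhds hH),
    hy.eventually (eventually_abs_const_div_lt_one t)] with x hx hx1
  have hwx : t / (x * (h x / g x)) = t / x * g x * (h x)⁻¹ := congrFun hw x
  simp only [Function.comp, hwx] at hx1 ⊢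
  obtain ⟨h1, h2⟩ := abs_lt.1 hx1
  rw [← hM _ _ _ hx (by linarith) (by linarith)]
  congr 1 <;> field_simp

/-! ### The coefficients of the resultant mean-map -/

theorem coeff_homogComp_mk (a g h : ℕ → ℝ) (hg : g 0 ≠ 0) (hh : h 0 ≠ 0) (m : ℕ) :
    coeff m (homogComp a (mk g) (mk h)) =
      ∑ n ∈ Finset.range (m + 1), a n * ∑ k ∈ Finset.range (m - n + 1),
        powCoeff n g k * powCoeff (-(n : ℝ) + 1) h (m - n - k) := by
  have hg' : constantCoeff (mk g) ≠ 0 := by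
    rwa [← coeff_zero_eq_constantCoeff_apply, coeff_mk]
  have hh' : constantCoeff (mk h) ≠ 0 := by
    rwa [← coeff_zero_eq_constantCoeff_apply, coeff_mk]
  rw [homogComp, coeff_mk]
  refine Finset.sum_congr rfl fun n _ => ?_
  rw [coeff_mul, Finset.Nat.sum_antidiagonal_eq_sum_range_succ_mk]
  simp only [coeff_pow_eq_powCoeff _ hg', coeff_mul_inv_pow_eq_powCoeff _ hh', coeff_mk,
    Nat.succ_eq_add_one]

theorem seqS_eq_coeff (aM aN : ℕ → ℝ) (h1 : aN 1 ≠ 1) (h2 : aN 1 ≠ -1) (m : ℕ) :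
    seqS aM aN m = coeff m (homogComp aM (mk (seqG' aN)) (mk (seqH' aN)) +
      homogComp aM (mk (seqG aN)) (mk (seqH aN))) := by
  have hg : seqG aN 0 ≠ 0 := fun h => h2 (by simp [seqG] at h; linarith)
  have hg' : seqG' aN 0 ≠ 0 := fun h => h1 (by simp [seqG'] at h; linarith)
  rw [map_add, coeff_homogComp_mk _ _ _ hg' (by simp [seqH']),
    coeff_homogComp_mk _ _ _ hg (by simp [seqH]), ← Finset.sum_add_distrib]
  simp only [seqS, Finset.sum_add_distrib, mul_add]

theorem seqD_eq_coeff (aM aN : ℕ → ℝ) (h1 : aN 1 ≠ 1) (h2 : aN 1 ≠ -1) (j : ℕ) :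
    seqD aM aN j = coeff (j + 1) (homogComp aM (mk (seqG' aN)) (mk (seqH' aN)) -
      homogComp aM (mk (seqG aN)) (mk (seqH aN))) := by
  have hg : seqG aN 0 ≠ 0 := fun h => h2 (by simp [seqG] at h; linarith)
  have hg' : seqG' aN 0 ≠ 0 := fun h => h1 (by simp [seqG'] at h; linarith)
  rw [map_sub, coeff_homogComp_mk _ _ _ hg' (by simp [seqH']),
    coeff_homogComp_mk _ _ _ hg (by simp [seqH]), ← Finset.sum_sub_distrib]
  simp only [seqD, Finset.sum_sub_distrib, mul_sub]

theorem coeff_zero_homogComp (a : ℕ → ℝ) (G H : PowerSeries ℝ) :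
    coeff 0 (homogComp a G H) = a 0 * constantCoeff H := by
  simp [homogComp]

theorem coeff_one_homogComp (a : ℕ → ℝ) (G H : PowerSeries ℝ) (hH : constantCoeff H ≠ 0) :
    coeff 1 (homogComp a G H) = a 0 * coeff 1 H + a 1 * constantCoeff G := by
  simp [homogComp, Finset.sum_range_succ, hH]

theorem seqS_zero (aM aN : ℕ → ℝ) : seqS aM aN 0 = 4 * aM 0 := by
  simp [seqS, powCoeff_zero, seqH, seqH']
  ring

theorem seqD_zero (aM aN : ℕ → ℝ) (h1 : aN 1 ≠ 1) (h2 : aN 1 ≠ -1) :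
    seqD aM aN 0 = 2 * (aM 0 - aM 1 * aN 1) := by
  rw [seqD_eq_coeff aM aN h1 h2, zero_add, map_sub,
    coeff_one_homogComp _ _ _ (by simp [seqH']),
    coeff_one_homogComp _ _ _ (by simp [seqH])]
  simp [seqG, seqG', seqH, seqH']
  ring

/-- The two expansions of `M` have the same leading term, which is why `seqD` starts one index
later. -/
theorem X_mul_mk_seqD (aM aN : ℕ → ℝ) (h1 : aN 1 ≠ 1) (h2 : aN 1 ≠ -1) :
    X * mk (seqD aM aN) = homogComp aM (mk (seqG' aN)) (mk (seqH' aN)) -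
      homogComp aM (mk (seqG aN)) (mk (seqH aN)) := by
  ext n
  cases n with
  | zero =>
    rw [map_sub, coeff_zero_homogComp, coeff_zero_homogComp]
    simp [seqH, seqH']
  | succ n => rw [coeff_succ_X_mul, coeff_mk, seqD_eq_coeff aM aN h1 h2]

theorem mk_seqS (aM aN : ℕ → ℝ) (h1 : aN 1 ≠ 1) (h2 : aN 1 ≠ -1) :
    mk (seqS aM aN) = homogComp aM (mk (seqG' aN)) (mk (seqH' aN)) +
      homogComp aM (mk (seqG aN)) (mk (seqH aN)) := by
  ext n
  rw [coeff_mk, seqS_eq_coeff aM aN h1 h2]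

theorem X_mul_mk_seqG (a : ℕ → ℝ) (ha : a 0 = 1) :
    X * mk (seqG a) = mk a - 1 + X := by
  ext n
  rcases n with _ | _ | n <;> simp [coeff_succ_X_mul, seqG, coeff_one, coeff_X, ha]
  ring

theorem X_mul_mk_seqG' (a : ℕ → ℝ) (ha : a 0 = 1) :
    X * mk (seqG' a) = 1 + X - mk a := by
  ext n
  rcases n with _ | _ | n <;> simp [coeff_succ_X_mul, seqG', coeff_one, coeff_X, ha]

theorem mk_seqH (a : ℕ → ℝ) (ha : a 0 = 1) : mk (seqH a) = 1 - X + mk a := by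
  ext n
  rcases n with _ | _ | n <;> simp [seqH, coeff_one, coeff_X, ha]
  · norm_num
  · ring

theorem mk_seqH' (a : ℕ → ℝ) (ha : a 0 = 1) : mk (seqH' a) = 1 + X + mk a := by
  ext n
  rcases n with _ | _ | n <;> simp [seqH', coeff_one, coeff_X, ha]
  norm_num

theorem mk_resultantCoeff (aK aM aN : ℕ → ℝ) (hD : seqD aM aN 0 ≠ 0) (hS : seqS aM aN 0 ≠ 0) :
    mk (resultantCoeff aK aM aN) =
      C (1 / 4) * homogComp aK (mk (seqD aM aN)) (mk (seqS aM aN)) := by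
  ext m
  rw [coeff_mk, coeff_C_mul, coeff_homogComp_mk _ _ _ hD hS, resultantCoeff]
  simp only [Finset.mul_sum, mul_assoc]

/-! ### The expansion of the resultant mean-map -/

theorem asympSeries_resultant {K M N : ℝ → ℝ → ℝ}
    (hM : IsMean M) (hN : IsMean N)
    (hK' : IsHomogeneous K) (hM' : IsHomogeneous M)
    {t : ℝ} (ht : t ≠ 0) {aK aM aN : ℕ → ℝ}
    (haK : AsympSeries atTop (fun x => t / x) (fun x => K (1 - t / x) (1 + t / x)) (mk aK))
    (haM : AsympSeries atTop (fun x => t / x) (fun x => M (1 - t / x) (1 + t / x)) (mk aM))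
    (haN : AsympSeries atTop (fun x => t / x) (fun x => N (1 - t / x) (1 + t / x)) (mk aN))
    (h1 : aN 1 ≠ 1) (h2 : aN 1 ≠ -1) :
    AsympSeries atTop (fun x => t / x) (fun x => resultant K M N (1 - t / x) (1 + t / x))
      (mk (resultantCoeff aK aM aN)) := by
  have hu := tendsto_const_div_atTop_zero t
  have hu0 := eventually_const_div_ne_zero ht
  have hN0 := coeff_zero_of_isMean hN haN
  have hM0 := coeff_zero_of_isMean hM haM
  have hM1 := abs_coeff_one_le_of_isMean hM ht haM
  obtain ⟨hNl, hNr⟩ := abs_le.1 (abs_coeff_one_le_of_isMean hN ht haN)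
  have hNl' : -1 < aN 1 := lt_of_le_of_ne hNl h2.symm
  have hNr' : aN 1 < 1 := lt_of_le_of_ne hNr h1
  have hD0 : 0 < seqD aM aN 0 := by
    rw [seqD_zero aM aN h1 h2, hM0]
    have : |aM 1 * aN 1| < 1 := by
      rw [abs_mul]
      exact mul_lt_one_of_nonneg_of_lt_one_right hM1 (abs_nonneg _) (abs_lt.2 ⟨hNl', hNr'⟩)
    linarith [(abs_lt.1 this).2]
  have hS0 : 0 < seqS aM aN 0 := by
    rw [seqS_zero, hM0]
    norm_num
  have hone := AsympSeries.one (l := atTop) (u := fun x : ℝ => t / x)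
  have hself := AsympSeries.self (l := atTop) (u := fun x : ℝ => t / x)
  have hpos := eventually_abs_const_div_lt_one t
  -- The pairs `2 (1 - u, N)` and `2 (N, 1 + u)` are `(h - u g, h + u g)` for these `g` and `h`.
  have hg := (X_mul_mk_seqG aN hN0 ▸ (haN.sub hone).add hself).div_X hu hu0
  have hg' := (X_mul_mk_seqG' aN hN0 ▸ (hone.add hself).sub haN).div_X hu hu0
  have hh := mk_seqH aN hN0 ▸ (hone.sub hself).add haN
  have hh' := mk_seqH' aN hN0 ▸ (hone.add hself).add haN
  have hB : AsympSeries atTop (fun x => t / x)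
      (fun x => 2 * M (1 - t / x) (N (1 - t / x) (1 + t / x)))
      (homogComp aM (mk (seqG aN)) (mk (seqH aN))) := by
    refine (asympSeries_mean_comp hM' haM hg hh
      (by rw [constantCoeff_mk, seqG, if_pos rfl]; linarith)
      (by simp [seqH])).congr' ?_
    filter_upwards [hu0, hpos] with x hx hx1
    obtain ⟨hl, hr⟩ := abs_lt.1 hx1
    rw [mul_div_cancel₀ _ hx, ← hM' 2 _ _ two_pos (by linarith)
      (hN.pos (by linarith) (by linarith))]
    congr 1 <;> ring
  have hB' : AsympSeries atTop (fun x => t / x)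
      (fun x => 2 * M (N (1 - t / x) (1 + t / x)) (1 + t / x))
      (homogComp aM (mk (seqG' aN)) (mk (seqH' aN))) := by
    refine (asympSeries_mean_comp hM' haM hg' hh'
      (by rw [constantCoeff_mk, seqG', if_pos rfl]; linarith)
      (by simp [seqH'])).congr' ?_
    filter_upwards [hu0, hpos] with x hx hx1
    obtain ⟨hl, hr⟩ := abs_lt.1 hx1
    rw [mul_div_cancel₀ _ hx, ← hM' 2 _ _ two_pos
      (hN.pos (by linarith) (by linarith)) (by linarith)]
    congr 1 <;> ring
  -- For the arguments of `K`, scaled by `4`: the half difference, divided by `u`, and the half sum.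
  have hd := (X_mul_mk_seqD aM aN h1 h2 ▸ hB'.sub hB).div_X hu hu0
  have hs := mk_seqS aM aN h1 h2 ▸ hB'.add hB
  have hR := (AsympSeries.polynomial (Polynomial.C (1 / 4))).mul hu
    (asympSeries_mean_comp hK' haK hd hs (by rwa [constantCoeff_mk]) (by rwa [constantCoeff_mk]))
  rw [mk_resultantCoeff aK aM aN hD0.ne' hS0.ne', ← Polynomial.coe_C]
  refine hR.congr' ?_
  filter_upwards [hu0, hpos] with x hx hx1
  obtain ⟨hl, hr⟩ := abs_lt.1 hx1
  have hNx : 0 < N (1 - t / x) (1 + t / x) := hN.pos (by linarith) (by linarith)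
  have hA := hM.pos (s := 1 - t / x) (by linarith) hNx
  have hA' := hM.pos (t := 1 + t / x) hNx (by linarith)
  rw [mul_div_cancel₀ _ hx, resultant, Polynomial.eval_C, one_div,
    inv_mul_eq_iff_eq_mul₀ four_ne_zero, ← hK' 4 _ _ four_pos hA hA']
  congr 1 <;> ring

/-- For `t = 0` all terms after the first vanish, so the other coefficients are arbitrary. -/
theorem hasExpansionAt_zero_iff {M : ℝ → ℝ → ℝ} (hM : ∀ x, 0 < x → M x x = x) (a : ℕ → ℝ) :
    HasExpansionAt M 0 a ↔ a 0 = 1 := by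
  have key : ∀ n : ℕ, (fun x => M (x - 0) (x + 0) -
      ∑ k ∈ Finset.range (n + 1), a k * 0 ^ k * x ^ (1 - (k : ℤ))) =ᶠ[atTop]
        fun x => (1 - a 0) * x := by
    intro n
    filter_upwards [eventually_gt_atTop 0] with x hx
    rw [Finset.sum_range_succ', Finset.sum_eq_zero fun k _ => by simp, sub_zero, add_zero, hM x hx]
    simp
    ring
  constructor
  · intro h
    have h0 := ((h 0).congr' (key 0) EventuallyEq.rfl)
    by_contra hne
    have h1 : (fun x : ℝ => x) =o[atTop] fun x : ℝ => x := by
      simpa [isLittleO_const_mul_left_iff (sub_ne_zero.2 (Ne.symm hne))] using h0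
    exact isLittleO_irrefl ((eventually_gt_atTop 0).mono fun x hx => ne_of_gt hx).frequently h1
  · intro h n
    refine (isLittleO_zero _ _).congr' ?_ EventuallyEq.rfl
    filter_upwards [key n] with x hx
    rw [hx, h, sub_self, zero_mul]

end

theorem mainTheorem1 (K M N : ℝ → ℝ → ℝ)
    (hK : IsMean K) (hM : IsMean M) (hN : IsMean N)
    (hK' : IsHomogeneous K) (hM' : IsHomogeneous M) (hN' : IsHomogeneous N)
    (t : ℝ) (aK aM aN : ℕ → ℝ)
    (haK : HasExpansionAt K t aK) (haM : HasExpansionAt M t aM) (haN : HasExpansionAt N t aN)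
    (h1 : aN 1 ≠ 1) (h2 : aN 1 ≠ -1) :
    HasExpansionAt (resultant K M N) t (resultantCoeff aK aM aN) ∧
      (t ≠ 0 → ∀ b : ℕ → ℝ, HasExpansionAt (resultant K M N) t b →
        b = resultantCoeff aK aM aN) := by
  rcases eq_or_ne t 0 with rfl | ht
  · refine ⟨?_, fun h => absurd rfl h⟩
    rw [hasExpansionAt_zero_iff fun x hx => hK.self hx] at haK
    rw [hasExpansionAt_zero_iff fun x hx => hM.self hx] at haM
    refine (hasExpansionAt_zero_iff (fun x hx => ?_) _).2 ?_
    · rw [resultant, hN.self hx, hM.self hx, hK.self hx]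
    · simp [resultantCoeff, powCoeff_zero, seqS_zero, haK, haM]
  · have hR' := isHomogeneous_resultant hM hN hK' hM' hN'
    rw [hasExpansionAt_iff hK' ht] at haK
    rw [hasExpansionAt_iff hM' ht] at haM
    rw [hasExpansionAt_iff hN' ht] at haN
    have hR := asympSeries_resultant hM hN hK' hM' ht haK haM haN h1 h2
    refine ⟨(hasExpansionAt_iff hR' ht _).2 hR, fun _ b hb => ?_⟩
    have h := AsympSeries.unique (tendsto_const_div_atTop_zero t)
      (eventually_const_div_ne_zero ht) ((hasExpansionAt_iff hR' ht _).1 hb) hR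
    funext n
    simpa using congrArg (PowerSeries.coeff n) h
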